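/- Let $p$ be a prime and let $G$ be a finite group. For a finite group $H$, let $O_p(H)$ be its largest normal $p$-subgroup; $H$ has characteristic $p$ if $C_H(O_p(H)) \le O_p(H)$. Assume that $G$ has parabolic characteristic $p$: whenever $P$ is a nontrivial $p$-subgroup of $G$ such that $N_G(P)$ contains a Sylow $p$-subgroup of $G$, the group $N_G(P)$ has characteristic $p$. An element of $G$ is called $p$-central if it has order $p$ and lies in the center of some Sylow $p$-subgroup of $G$. Let $\widehat{\mathcal{S}}_p(G)$ be the set of nontrivial $p$-subgroups $P$ of $G$ whose center $Z(P)$ contains a $p$-central element of $G$, and let $\widetilde{\mathcal{S}}_p(G)$ be the set of nontrivial $p$-subgroups of $G$ which contain a $p$-central element of $G$. Let $T$ be a subgroup of $G$ of order $p$ of noncentral type, that is, no nonidentity element of $T$ is conjugate in $G$ to an element of the center of a Sylow $p$-subgroup of $G$. Put $C = C_G(T)$ and $O_C = O_p(C)$. Then: (a) if $O_C \in \widetilde{\mathcal{S}}_p(G)$, then the fixed point set $\widehat{\mathcal{S}}_p(G)^T = \{Q \in \widehat{\mathcal{S}}_p(G) \mid T \le N_G(Q)\}$, partially ordered by inclusion,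 is contractible, that is, the geometric realization of the simplicial complex of its nonempty chains is a contractible topological space; (b) $O_C \in \widetilde{\mathcal{S}}_p(G)$ if and only if $C$ has characteristic $p$. -/

import Mathlib

/-! ### Simplicial complexes attached to finite posets -/

/-- The order complex of a poset: its simplices are the nonempty finite chains. -/
def orderComplex (α : Type*) [PartialOrder α] : AbstractSimplicialComplex α where
  faces := {s | s.Nonempty ∧ IsChain (· ≤ ·) (s : Set α)}
  isRelLowerSet_faces := fun _ hs =>
    ⟨hs.1, fun _ hts ht => ⟨ht, hs.2.mono (Finset.coe_subset.mpr hts)⟩⟩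
  singleton_mem := fun v => ⟨Finset.singleton_nonempty v, by simp⟩

/-- The geometric realization of a simplicial complex with finitely many vertices, in
barycentric coordinates: the functions `w ≥ 0` on the vertices that are supported on a face and
have total mass `1`. It carries the subspace topology of `α → ℝ` (a finite-dimensional
real vector space, as `α` is finite). -/
def geomRealization {α : Type*} [Finite α] (K : AbstractSimplicialComplex α) : Set (α → ℝ) :=
  {w | (∀ a, 0 ≤ w a) ∧ ∃ s ∈ K.faces, (∀ a, a ∉ s → w a = 0) ∧ ∑ a ∈ s, w a = 1}

/-! ### `O_p`, groups of (parabolic) characteristic `p` -/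

/-- `O_p(H)`: the largest normal `p`-subgroup of a group `H`, as the join of all normal
`p`-subgroups. -/
def pCore (p : ℕ) (H : Type*) [Group H] : Subgroup H :=
  sSup {N : Subgroup H | N.Normal ∧ IsPGroup p N}

/-- For a finite group, `pCore p H` is indeed the largest normal `p`-subgroup. -/
theorem pCore_isGreatest (p : ℕ) (H : Type*) [Group H] [Finite H] :
    IsGreatest {N : Subgroup H | N.Normal ∧ IsPGroup p N} (pCore p H) := by
  refine ⟨?_, fun N hN => le_sSup hN⟩
  have key : ∀ s : Set (Subgroup H), s.Finite →
      (∀ N ∈ s, N.Normal ∧ IsPGroup p N) → (sSup s).Normal ∧ IsPGroup p (sSup s : Subgroup H) := by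
    intro s hs
    induction s, hs using Set.Finite.induction_on with
    | empty =>
      intro _
      rw [sSup_empty]
      exact ⟨inferInstance, IsPGroup.of_bot⟩
    | insert _ _ ih =>
      intro h
      rw [sSup_insert]
      obtain ⟨h1, h2⟩ := h _ (Set.mem_insert _ _)
      obtain ⟨h3, h4⟩ := ih fun N hN => h N (Set.mem_insert_of_mem _ hN)
      exact ⟨Subgroup.sup_normal _ _, h2.to_sup_of_normal_right h4⟩
  exact key _ (Set.toFinite _) fun _ h => h

/-- `H` has characteristic `p`: `C_H(O_p(H)) ≤ O_p(H)`. -/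
def HasCharacteristicP (p : ℕ) (H : Type*) [Group H] : Prop :=
  Subgroup.centralizer (pCore p H : Set H) ≤ pCore p H

/-- A `p`-local subgroup: the normalizer of a nontrivial `p`-subgroup. -/
def IsPLocal {G : Type*} [Group G] (p : ℕ) (H : Subgroup G) : Prop :=
  ∃ P : Subgroup G, IsPGroup p P ∧ P ≠ ⊥ ∧ H = Subgroup.normalizer (P : Set G)

/-- A parabolic subgroup: one that contains a Sylow `p`-subgroup of `G`. -/
def IsParabolic {G : Type*} [Group G] (p : ℕ) (H : Subgroup G) : Prop :=
  ∃ S : Sylow p G, (S : Subgroup G) ≤ H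

/-- `G` has parabolic characteristic `p`: all `p`-local, parabolic subgroups of `G` have
characteristic `p`. -/
def HasParabolicCharacteristicP (p : ℕ) (G : Type*) [Group G] : Prop :=
  ∀ H : Subgroup G, IsPLocal p H → IsParabolic p H → HasCharacteristicP p H

/-! ### `p`-central elements and distinguished collections -/

/-- The center `Z(P)` of a subgroup `P` of `G`, as a subgroup of `G`. -/
def centerOf {G : Type*} [Group G] (P : Subgroup G) : Subgroup G :=
  (Subgroup.center P).map P.subtype

/-- `x` is `p`-central in `G`: it has order `p` and lies in the center of a Sylow
`p`-subgroup of `G`. -/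
def IsPCentral {G : Type*} [Group G] (p : ℕ) (x : G) : Prop :=
  orderOf x = p ∧ ∃ S : Sylow p G, x ∈ centerOf (S : Subgroup G)

/-- `Ω₁(H)`: the subgroup generated by the elements `x` of `H` with `x ^ p = 1`. -/
def omegaOne {G : Type*} [Group G] (p : ℕ) (H : Subgroup G) : Subgroup G :=
  Subgroup.closure {x | x ∈ H ∧ x ^ p = 1}

/-- The subgroup of `G` generated by the `p`-central elements of `G` that lie in `Ω₁(Z(P))`. -/
def hatSubgroup {G : Type*} [Group G] (p : ℕ) (P : Subgroup G) : Subgroup G :=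
  Subgroup.closure {x | x ∈ omegaOne p (centerOf P) ∧ IsPCentral p x}

/-- The Brown collection `S_p(G)` of nontrivial `p`-subgroups of `G`. -/
def brownCollection (p : ℕ) (G : Type*) [Group G] : Set (Subgroup G) :=
  {P | IsPGroup p P ∧ P ≠ ⊥}

/-- The distinguished Brown collection: the nontrivial `p`-subgroups of `G` which contain
`p`-central elements of `G` in their centers. -/
def distinguishedBrown (p : ℕ) (G : Type*) [Group G] : Set (Subgroup G) :=
  {P | P ∈ brownCollection p G ∧ hatSubgroup p P ≠ ⊥}

/-- The collection of the nontrivial `p`-subgroups of `G` which contain a `p`-central element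
of `G`. -/
def tildeBrown (p : ℕ) (G : Type*) [Group G] : Set (Subgroup G) :=
  {P | P ∈ brownCollection p G ∧ ∃ x ∈ P, IsPCentral p x}

/-- The fixed points of `T`, acting by conjugation, on a collection of subgroups. -/
def fixedCollection {G : Type*} [Group G] (C : Set (Subgroup G)) (T : Subgroup G) :
    Set (Subgroup G) :=
  {Q | Q ∈ C ∧ T ≤ Subgroup.normalizer (Q : Set G)}

/-- A collection of subgroups of a finite group, ordered by inclusion, is contractible if the
realization of its order complex is a contractible space. -/
def IsContractibleCollection {G : Type*} [Group G] [Finite G] (C : Set (Subgroup G)) : Prop :=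
  ContractibleSpace (geomRealization (orderComplex C))

/-- `x` is of noncentral type: it has order `p` and is not conjugate to any element of the center
of a Sylow `p`-subgroup of `G`. -/
def IsNoncentralElement {G : Type*} [Group G] (p : ℕ) (x : G) : Prop :=
  orderOf x = p ∧ ∀ S : Sylow p G, ∀ z ∈ centerOf (S : Subgroup G), ¬ IsConj x z

/-- `T` is a subgroup of order `p` of noncentral type. -/
def IsNoncentralSubgroup {G : Type*} [Group G] (p : ℕ) (T : Subgroup G) : Prop :=
  Nat.card T = p ∧ ∀ x ∈ T, x ≠ 1 → IsNoncentralElement p x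

/-- `O_p(C_G(T))`, as a subgroup of `G`. -/
def centralizerCore {G : Type*} [Group G] (p : ℕ) (T : Subgroup G) : Subgroup G :=
  (pCore p (Subgroup.centralizer (T : Set G))).map (Subgroup.centralizer (T : Set G)).subtype

/-! Write `O` for `O_p(C)`, and call the collections `hat` (`distinguishedBrown`) and `tilde`
(`tildeBrown`). On the group side, parabolic characteristic `p` gives characteristic `p` to `C_G(z)`
for `p`-central `z`, because it is normal in the `p`-local parabolic subgroup `N_G(⟨z⟩)`. Thompson's
`P × Q` lemma carries this up to `C_G(P)` for every `P` in `tilde`. Two consequences follow. For `P`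
in `tilde`, `O_p(N_G(P))` is self-centralizing, hence lies in `hat`. If `O` is in `tilde`, then
`C_G(O) ≤ O`, which is (b), since conversely a self-centralizing `O` contains the center of a Sylow
subgroup.

For (a), the map `Q ↦ QT` would retract the fixed points onto the groups containing `T`, but it may
leave `hat`. It does preserve `tilde`, so the proof detours through `tilde`. The members of `hat`
above `T` are contracted by `Q ≥ C_Q(T) ≤ C_Q(T)O ≥ O`. For `P` in `tilde` but not in `hat`, `P <
O_p(N_G(P))`, and the fixed points above `P` are contracted by `R ≥ N_R(P) ≤ N_R(P)O_p(N_G(P)) ≥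
O_p(N_G(P))`. Such `P` therefore have contractible links and can be deleted, so `hat` may be
exchanged for `tilde` both above `T` and among all fixed points.

The topology is done directly in barycentric coordinates: comparable monotone maps are homotopic
(`chainMap_homotopic`), and a vertex with contractible link can be removed
(`exists_deformation_of_contractible_link`). -/

open scoped unitInterval

/-! ### Realizations in ambient coordinates, and homotopies between comparable monotone maps -/

section ChainRealization

variable {α : Type*} [PartialOrder α] [Fintype α]

/-- The realization of the order complex of a subset `C` of a finite poset `α`, in the barycentric
coordinates of the ambient poset. -/
def chainRealization (C : Set α) : Set (α → ℝ) :=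
  {w | (∀ a, 0 ≤ w a) ∧ (∀ a, w a ≠ 0 → a ∈ C) ∧
    (∀ a b, w a ≠ 0 → w b ≠ 0 → a ≤ b ∨ b ≤ a) ∧ ∑ a, w a = 1}

theorem chainRealization_mono {C D : Set α} (h : C ⊆ D) :
    chainRealization C ⊆ chainRealization D :=
  fun _ hw => ⟨hw.1, fun a ha => h (hw.2.1 a ha), hw.2.2⟩

theorem chainRealization_le_one {C : Set α} {w : α → ℝ} (hw : w ∈ chainRealization C) (a : α) :
    w a ≤ 1 := by
  rw [← hw.2.2.2]
  exact Finset.single_le_sum (fun b _ => hw.1 b) (Finset.mem_univ a)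

/-- Compactness is what later makes a continuous surjection onto the realization a quotient map. The
support conditions become closed once written as equations: incomparable elements have weights with
product zero. -/
theorem isCompact_chainRealization (C : Set α) : IsCompact (chainRealization C) := by
  have hsub : chainRealization C ⊆ Set.Icc (0 : α → ℝ) 1 := fun w hw =>
    ⟨fun a => hw.1 a, fun a => chainRealization_le_one hw a⟩
  refine isCompact_Icc.of_isClosed_subset ?_ hsub
  have h : chainRealization C = {w : α → ℝ | ∀ a, 0 ≤ w a} ∩ {w | ∀ a, a ∉ C → w a = 0} ∩
      {w | ∀ a b, ¬ (a ≤ b ∨ b ≤ a) → w a * w b = 0} ∩ {w | ∑ a, w a = 1} := by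
    ext w
    simp only [chainRealization, Set.mem_inter_iff, Set.mem_ofPred_eq]
    constructor
    · rintro ⟨h1, h2, h3, h4⟩
      refine ⟨⟨⟨h1, fun a ha => by_contra fun h => ha (h2 a h)⟩, fun a b hab => ?_⟩, h4⟩
      by_contra h
      exact hab (h3 a b (left_ne_zero_of_mul h) (right_ne_zero_of_mul h))
    · rintro ⟨⟨⟨h1, h2⟩, h3⟩, h4⟩
      refine ⟨h1, fun a ha => by_contra fun h => ha (h2 a h), fun a b ha hb => ?_, h4⟩
      by_contra h
      exact mul_ne_zero ha hb (h3 a b h)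
  rw [h]
  refine IsClosed.inter (IsClosed.inter (IsClosed.inter ?_ ?_) ?_) ?_
  · simp only [Set.ofPred_forall]
    exact isClosed_iInter fun a => isClosed_le continuous_const (continuous_apply a)
  · simp only [Set.ofPred_forall]
    exact isClosed_iInter fun a => isClosed_iInter fun _ =>
      isClosed_eq (continuous_apply a) continuous_const
  · simp only [Set.ofPred_forall]
    exact isClosed_iInter fun a => isClosed_iInter fun b => isClosed_iInter fun _ =>
      isClosed_eq ((continuous_apply a).mul (continuous_apply b)) continuous_const
  · exact isClosed_eq (continuous_finsetSum _ fun a _ => continuous_apply a) continuous_const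

instance (C : Set α) : CompactSpace (chainRealization C) :=
  isCompact_iff_compactSpace.mp (isCompact_chainRealization C)

open Classical in
/-- The pushforward of a weight function `u` along `φ`. -/
noncomputable def pushWeights {ι α : Type*} [Fintype ι] (φ : ι → α) (u : ι → ℝ) : α → ℝ :=
  fun b => ∑ i, if φ i = b then u i else 0

theorem pushWeights_zero {ι α : Type*} [Fintype ι] (φ : ι → α) :
    pushWeights φ (0 : ι → ℝ) = 0 := by
  ext b
  exact Finset.sum_eq_zero fun i _ => by split_ifs <;> rfl

theorem pushWeights_sumElim {ι κ α : Type*} [Fintype ι] [Fintype κ] (φ : ι → α) (ψ : κ → α)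
    (u : ι → ℝ) (v : κ → ℝ) :
    pushWeights (Sum.elim φ ψ) (Sum.elim u v) = pushWeights φ u + pushWeights ψ v := by
  ext b
  exact Fintype.sum_sum_type _

theorem continuous_pushWeights {ι α X : Type*} [Fintype ι] [TopologicalSpace X] (φ : ι → α)
    {u : X → ι → ℝ} (hu : Continuous u) : Continuous fun x => pushWeights φ (u x) := by
  refine continuous_pi fun b => continuous_finsetSum _ fun i _ => ?_
  split_ifs
  · exact (continuous_apply i).comp hu
  · exact continuous_const

theorem pushWeights_mem {ι : Type*} [Fintype ι] {D : Set α} {φ : ι → α} {u : ι → ℝ}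
    (h0 : ∀ i, 0 ≤ u i) (h1 : ∀ i, u i ≠ 0 → φ i ∈ D)
    (h2 : ∀ i j, u i ≠ 0 → u j ≠ 0 → φ i ≤ φ j ∨ φ j ≤ φ i) (h3 : ∑ i, u i = 1) :
    pushWeights φ u ∈ chainRealization D := by
  classical
  have key : ∀ b, pushWeights φ u b ≠ 0 → ∃ i, φ i = b ∧ u i ≠ 0 := by
    intro b hb
    obtain ⟨i, -, hi⟩ := Finset.exists_ne_zero_of_sum_ne_zero hb
    by_cases h : φ i = b
    · exact ⟨i, h, by simpa [h] using hi⟩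
    · simp [h] at hi
  refine ⟨fun b => Finset.sum_nonneg fun i _ => ?_, fun b hb => ?_, fun a b ha hb => ?_, ?_⟩
  · split_ifs
    exacts [h0 i, le_rfl]
  · obtain ⟨i, rfl, hi⟩ := key b hb
    exact h1 i hi
  · obtain ⟨i, rfl, hi⟩ := key a ha
    obtain ⟨j, rfl, hj⟩ := key b hb
    exact h2 i j hi hj
  · simp only [pushWeights]
    rw [Finset.sum_comm]
    simpa using h3

/-- The map of realizations induced by a map that is monotone on `C`. -/
noncomputable def chainMap {C D : Set α} (f : α → α) (hf : Set.MapsTo f C D) (hm : MonotoneOn f C) :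
    C(chainRealization C, chainRealization D) where
  toFun w := ⟨pushWeights f w.1, pushWeights_mem w.2.1 (fun a ha => hf (w.2.2.1 a ha))
    (fun a b ha hb => (w.2.2.2.1 a b ha hb).imp
      (fun h => hm (w.2.2.1 a ha) (w.2.2.1 b hb) h)
      (fun h => hm (w.2.2.1 b hb) (w.2.2.1 a ha) h)) w.2.2.2.2⟩
  continuous_toFun := (continuous_pushWeights f continuous_subtype_val).subtype_mk _

theorem chainMap_id {C D : Set α} (f : α → α) (hf : Set.MapsTo f C D) (hm : MonotoneOn f C)
    (h : ∀ a ∈ C, f a = a) (w : chainRealization C) : (chainMap f hf hm w).1 = w.1 := by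
  classical
  ext b
  change ∑ a, (if f a = b then w.1 a else 0) = w.1 b
  have : ∀ a, (if f a = b then w.1 a else 0) = if a = b then w.1 a else 0 := by
    intro a
    by_cases ha : w.1 a = 0
    · simp [ha]
    · rw [h a (w.2.2.1 a ha)]
  simp [this]

open Classical in
/-- The mass of `a` that lies in the upper part of total mass `s` of a weight `w` on a chain. -/
noncomputable def upperMass (s : ℝ) (w : α → ℝ) (a : α) : ℝ :=
  max 0 (min (w a) (s - ∑ b, if a < b then w b else 0))

theorem upperMass_nonneg (s : ℝ) (w : α → ℝ) (a : α) : 0 ≤ upperMass s w a := le_max_left _ _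

theorem upperMass_le {w : α → ℝ} (h : ∀ a, 0 ≤ w a) (s : ℝ) (a : α) : upperMass s w a ≤ w a :=
  max_le (h a) (min_le_left _ _)

theorem upperMass_zero {w : α → ℝ} (h : ∀ a, 0 ≤ w a) (a : α) : upperMass 0 w a = 0 := by
  refine max_eq_left ((min_le_right _ _).trans ?_)
  rw [zero_sub, neg_nonpos]
  exact Finset.sum_nonneg fun b _ => by split_ifs; exacts [h b, le_rfl]

theorem upper_add_le {w : α → ℝ} (h : ∀ a, 0 ≤ w a) (a : α) (s : Finset α)
    [DecidablePred (a < ·)] (hs : ∀ b, a < b → b ∈ s) (ha : a ∈ s) :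
    (∑ b, if a < b then w b else 0) + w a ≤ ∑ b ∈ s, w b := by
  classical
  rw [← Finset.sum_filter, add_comm, ← Finset.sum_insert (by simp)]
  refine Finset.sum_le_sum_of_subset_of_nonneg ?_ fun b _ _ => h b
  intro b hb
  rcases Finset.mem_insert.mp hb with rfl | hb
  · exact ha
  · exact hs b (Finset.mem_filter.mp hb).2

theorem upperMass_one {w : α → ℝ} (h : ∀ a, 0 ≤ w a) (h1 : ∑ a, w a = 1) (a : α) :
    upperMass 1 w a = w a := by
  classical
  have := upper_add_le h a Finset.univ (by simp) (by simp)
  rw [h1] at this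
  rw [upperMass, min_eq_left, max_eq_right (h a)]
  linarith

/-- If `a < b`, some mass of `a` in the upper part forces the mass strictly above `a` to be less
than `s`, whereas some mass of `b` outside it forces the mass from `b` upwards to exceed `s`. The
latter mass is part of the former. -/
theorem le_of_upperMass {w : α → ℝ} (h : ∀ a, 0 ≤ w a)
    {s : ℝ} {a b : α} (hcomp : a ≤ b ∨ b ≤ a) (ha : upperMass s w a ≠ 0)
    (hb : w b - upperMass s w b ≠ 0) : b ≤ a := by
  classical
  rcases hcomp with hab | hba
  · rcases hab.eq_or_lt with rfl | hab
    · exact le_rfl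
    exfalso
    have h1 : (∑ c, if a < c then w c else 0) < s := by
      by_contra hc
      push Not at hc
      exact ha (max_eq_left ((min_le_right _ _).trans (by linarith)))
    have h2 : s < (∑ c, if b < c then w c else 0) + w b := by
      by_contra hc
      push Not at hc
      apply hb
      rw [upperMass, min_eq_left (by linarith), max_eq_right (h b), sub_self]
    have h3 := upper_add_le h b (Finset.univ.filter (a < ·))
      (fun c hc => by simpa using hab.trans hc) (by simpa using hab)
    rw [Finset.sum_filter] at h3
    linarith
  · exact hba

/-- At time `s`, the top part of mass `s` of the weight is pushed along `g` and the rest along `f`.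
The support stays a chain: if `a` keeps lower mass and `b` has upper mass, then `a ≤ b`, so `f a ≤ g
a ≤ g b`. This formula replaces a triangulation of the prism. -/
theorem chainMap_homotopic {C D : Set α} {f g : α → α} (hf : Set.MapsTo f C D)
    (hfm : MonotoneOn f C) (hg : Set.MapsTo g C D) (hgm : MonotoneOn g C)
    (hfg : ∀ a ∈ C, f a ≤ g a) : (chainMap f hf hfm).Homotopic (chainMap g hg hgm) := by
  classical
  let u : ℝ → (α → ℝ) → α ⊕ α → ℝ := fun s w =>
    Sum.elim (fun a => w a - upperMass s w a) (upperMass s w)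
  have hu : Continuous fun z : I × chainRealization C => u z.1 z.2.1 := by
    have hw : ∀ a : α, Continuous fun z : I × chainRealization C => z.2.1 a := fun a =>
      (continuous_apply a).comp (continuous_subtype_val.comp continuous_snd)
    have hm : ∀ a : α, Continuous fun z : I × chainRealization C => upperMass z.1 z.2.1 a := by
      intro a
      refine continuous_const.max ((hw a).min ?_)
      refine (continuous_subtype_val.comp continuous_fst).sub (continuous_finsetSum _ fun b _ => ?_)
      split_ifs
      exacts [hw b, continuous_const]
    refine continuous_pi fun i => ?_
    rcases i with a | a
    · exact (hw a).sub (hm a)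
    · exact hm a
  have hne : ∀ (s : ℝ) (w : chainRealization C) (a : α),
      (w.1 a - upperMass s w.1 a ≠ 0 ∨ upperMass s w.1 a ≠ 0) → w.1 a ≠ 0 := by
    intro s w a h h0
    have h1 := upperMass_nonneg s w.1 a
    have h2 := upperMass_le w.2.1 s a
    rw [h0] at h2 h
    have h3 : upperMass s w.1 a = 0 := le_antisymm h2 h1
    simp [h3] at h
  have hmem : ∀ z : I × chainRealization C,
      pushWeights (Sum.elim f g) (u z.1 z.2.1) ∈ chainRealization D := by
    rintro ⟨s, w⟩
    refine pushWeights_mem ?_ ?_ ?_ ?_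
    · rintro (a | a)
      · exact sub_nonneg.mpr (upperMass_le w.2.1 _ a)
      · exact upperMass_nonneg _ _ _
    · rintro (a | a) h
      · exact hf (w.2.2.1 a (hne _ w a (Or.inl h)))
      · exact hg (w.2.2.1 a (hne _ w a (Or.inr h)))
    · have hmix : ∀ a b, w.1 a - upperMass s w.1 a ≠ 0 → upperMass s w.1 b ≠ 0 → f a ≤ g b := by
        intro a b ha hb
        have ha' := hne _ w a (Or.inl ha)
        have hb' := hne _ w b (Or.inr hb)
        have hab := le_of_upperMass w.2.1 (w.2.2.2.1 b a hb' ha') hb ha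
        exact (hfg a (w.2.2.1 a ha')).trans (hgm (w.2.2.1 a ha') (w.2.2.1 b hb') hab)
      rintro (a | a) (b | b) ha hb
      · have ha' := hne _ w a (Or.inl ha)
        have hb' := hne _ w b (Or.inl hb)
        exact (w.2.2.2.1 a b ha' hb').imp (fun h => hfm (w.2.2.1 a ha') (w.2.2.1 b hb') h)
          (fun h => hfm (w.2.2.1 b hb') (w.2.2.1 a ha') h)
      · exact Or.inl (hmix a b ha hb)
      · exact Or.inr (hmix b a hb ha)
      · have ha' := hne _ w a (Or.inr ha)
        have hb' := hne _ w b (Or.inr hb)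
        exact (w.2.2.2.1 a b ha' hb').imp (fun h => hgm (w.2.2.1 a ha') (w.2.2.1 b hb') h)
          (fun h => hgm (w.2.2.1 b hb') (w.2.2.1 a ha') h)
    · simp [u, w.2.2.2.2]
  refine ⟨⟨⟨fun z => ⟨_, hmem z⟩, (continuous_pushWeights _ hu).subtype_mk _⟩, ?_, ?_⟩⟩
  · intro w
    refine Subtype.ext ?_
    change pushWeights (Sum.elim f g) (u 0 w.1) = pushWeights f w.1
    have h0 : upperMass 0 w.1 = 0 := funext (upperMass_zero w.2.1)
    simp only [u, pushWeights_sumElim, h0, pushWeights_zero, add_zero, Pi.zero_apply, sub_zero]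
  · intro w
    refine Subtype.ext ?_
    change pushWeights (Sum.elim f g) (u 1 w.1) = pushWeights g w.1
    have h1 : upperMass 1 w.1 = w.1 := funext (upperMass_one w.2.1 w.2.2.2.2)
    have h2 : (fun _ => 0 : α → ℝ) = 0 := rfl
    simp only [u, pushWeights_sumElim, h1, sub_self, h2, pushWeights_zero, zero_add]

end ChainRealization

/-! ### Removing vertices with contractible links -/

section Removal

variable {α : Type*} [PartialOrder α] [Fintype α]

open Classical in
/-- The point that divides the segment from `y` to the vertex `x` in the ratio `t : 1 - t`. -/
noncomputable def conePoint {α : Type*} (x : α) (y : α → ℝ) (t : ℝ) : α → ℝ :=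
  fun b => (if b = x then t else 0) + (1 - t) * y b

theorem conePoint_one {α : Type*} (x : α) (y y' : α → ℝ) : conePoint x y 1 = conePoint x y' 1 := by
  ext b
  simp [conePoint]

theorem conePoint_apply_self {α : Type*} {x : α} {y : α → ℝ} (hy : y x = 0) (t : ℝ) :
    conePoint x y t x = t := by
  simp [conePoint, hy]

/-- The elements of `D` that are comparable with `x` and different from `x`. -/
def posetLink (D : Set α) (x : α) : Set α := {y | y ∈ D ∧ (y < x ∨ x < y)}

theorem apply_eq_zero_of_notMem {C : Set α} {x : α} (hx : x ∉ C) (y : chainRealization C) :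
    y.1 x = 0 := by
  by_contra h
  exact hx (y.2.2.1 x h)

theorem conePoint_mem {D : Set α} {x : α} (hx : x ∈ D) (y : chainRealization (posetLink D x))
    (t : I) : conePoint x y.1 t ∈ chainRealization D := by
  classical
  have ht := t.2.1
  have ht' : 0 ≤ 1 - (t : ℝ) := sub_nonneg.mpr t.2.2
  have key : ∀ b, conePoint x y.1 t b ≠ 0 → b = x ∨ y.1 b ≠ 0 := by
    intro b hb
    by_contra! h
    simp [conePoint, h.1, h.2] at hb
  refine ⟨fun b => ?_, fun b hb => ?_, fun a b ha hb => ?_, ?_⟩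
  · refine add_nonneg ?_ (mul_nonneg ht' (y.2.1 b))
    split_ifs
    exacts [ht, le_rfl]
  · rcases key b hb with rfl | h
    exacts [hx, (y.2.2.1 b h).1]
  · rcases key a ha with rfl | h
    · rcases key b hb with rfl | h'
      · exact Or.inl le_rfl
      · exact ((y.2.2.1 b h').2.imp le_of_lt le_of_lt).symm
    · rcases key b hb with rfl | h'
      · exact (y.2.2.1 a h).2.imp le_of_lt le_of_lt
      · exact y.2.2.2.1 a b h h'
  · simp only [conePoint]
    rw [Finset.sum_add_distrib, ← Finset.mul_sum, y.2.2.2.2]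
    simp

theorem exists_conePoint_eq {D : Set α} {x : α} (hne : Nonempty (chainRealization (posetLink D x)))
    (w : chainRealization D) (hw : w.1 x ≠ 0) :
    ∃ (y : chainRealization (posetLink D x)) (t : I), conePoint x y.1 t = w.1 := by
  classical
  have hle := chainRealization_le_one w.2 x
  have hsum : w.1 x + ∑ b ∈ Finset.univ.erase x, w.1 b = 1 := by
    rw [Finset.add_sum_erase _ _ (Finset.mem_univ x), w.2.2.2.2]
  rcases hle.eq_or_lt with h1 | h1
  · obtain ⟨y⟩ := hne
    -- At the cone vertex the link coordinate is irrelevant; any point of the link serves.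
    refine ⟨y, 1, ?_⟩
    ext b
    have h0 : ∑ b ∈ Finset.univ.erase x, w.1 b = 0 := by linarith
    rw [Finset.sum_eq_zero_iff_of_nonneg fun b _ => w.2.1 b] at h0
    by_cases hb : b = x
    · subst hb
      simp [conePoint, h1]
    · simp [conePoint, hb, h0 b (by simp [hb])]
  · have hpos : 0 < 1 - w.1 x := sub_pos.mpr h1
    let y : α → ℝ := fun b => if b = x then 0 else w.1 b / (1 - w.1 x)
    have hy : ∀ b, y b ≠ 0 → b ≠ x ∧ w.1 b ≠ 0 := by
      intro b hb
      by_cases h : b = x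
      · simp [y, h] at hb
      · refine ⟨h, fun h' => hb ?_⟩
        simp [y, h']
    refine ⟨⟨y, fun b => ?_, fun b hb => ?_, fun a b ha hb => ?_, ?_⟩, ⟨w.1 x, w.2.1 x, hle⟩, ?_⟩
    · dsimp only [y]
      split_ifs
      exacts [le_rfl, div_nonneg (w.2.1 b) hpos.le]
    · obtain ⟨h, h'⟩ := hy b hb
      exact ⟨w.2.2.1 b h', (w.2.2.2.1 b x h' hw).imp (fun h1 => lt_of_le_of_ne h1 h)
        (fun h1 => lt_of_le_of_ne h1 h.symm)⟩
    · exact w.2.2.2.1 a b (hy a ha).2 (hy b hb).2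
    · have : ∑ b, y b = ∑ b ∈ Finset.univ.erase x, w.1 b / (1 - w.1 x) := by
        rw [← Finset.add_sum_erase _ _ (Finset.mem_univ x)]
        simp only [y, if_true, zero_add]
        exact Finset.sum_congr rfl fun b hb => if_neg (Finset.ne_of_mem_erase hb)
      rw [this, ← Finset.sum_div, div_eq_one_iff_eq hpos.ne']
      linarith
    · ext b
      by_cases hb : b = x
      · subst hb
        simp [conePoint, y]
      · simp only [conePoint, y, hb, if_false, zero_add]
        field_simp

/-- If the link of a vertex `x` is contractible, then the complex deformation retracts to
the subcomplex of the simplices that do not contain `x`. -/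
theorem exists_deformation_of_contractible_link {D : Set α} {x : α} (hx : x ∈ D)
    (hL : ContractibleSpace (chainRealization (posetLink D x))) :
    ∃ H : C(chainRealization D × I, chainRealization D), (∀ w, H (w, 0) = w) ∧
      (∀ w, (H (w, 1)).1 x = 0) ∧ ∀ w s, w.1 x = 0 → H (w, s) = w := by
  classical
  set K := chainRealization (posetLink D x) with hK
  have hxL : x ∉ posetLink D x := fun h => h.2.elim (lt_irrefl _) (lt_irrefl _)
  have hxD : x ∉ D \ {x} := fun h => h.2 rfl
  obtain ⟨y₀, ⟨h⟩⟩ := id_nullhomotopic K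
  let q : K × I → chainRealization D := fun z => ⟨conePoint x z.1.1 z.2, conePoint_mem hx z.1 z.2⟩
  have hq : Continuous q := by
    refine Continuous.subtype_mk (continuous_pi fun b => ?_) _
    have h1 : Continuous fun z : K × I => (z.2 : ℝ) := continuous_subtype_val.comp continuous_snd
    have h2 : Continuous fun z : K × I => z.1.1 b :=
      (continuous_apply b).comp (continuous_subtype_val.comp continuous_fst)
    refine Continuous.add ?_ ((continuous_const.sub h1).mul h2)
    split_ifs
    exacts [h1, continuous_const]
  have hqx : ∀ z, (q z).1 x = z.2 := fun z =>
    conePoint_apply_self (apply_eq_zero_of_notMem hxL z.1) _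
  let incl : chainRealization (D \ {x}) → chainRealization D :=
    Set.inclusion (chainRealization_mono Set.sdiff_subset)
  have hincl : Continuous incl := continuous_inclusion _
  have hinclx : ∀ b, (incl b).1 x = 0 := fun b => apply_eq_zero_of_notMem hxD b
  -- The complex is glued from the part avoiding `x` and the cone over the link. The homotopy is
  -- defined on the two pieces and descends along the quotient map `Q`.
  let Q : (chainRealization (D \ {x}) × I) ⊕ ((K × I) × I) → chainRealization D × I :=
    Sum.elim (Prod.map incl id) (Prod.map q id)
  have hQ : Continuous Q :=
    (hincl.prodMap continuous_id).sumElim (hq.prodMap continuous_id)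
  have hQs : Function.Surjective Q := by
    rintro ⟨w, s⟩
    by_cases hw : w.1 x = 0
    · refine ⟨Sum.inl (⟨w.1, w.2.1, fun a ha => ⟨w.2.2.1 a ha, ?_⟩, w.2.2.2⟩, s), rfl⟩
      rintro rfl
      exact ha hw
    · obtain ⟨y, t, hyt⟩ := exists_conePoint_eq ⟨y₀⟩ w hw
      exact ⟨Sum.inr ((y, t), s), Prod.ext (Subtype.ext hyt) rfl⟩
  have hquot : Topology.IsQuotientMap Q := hQ.isClosedMap.isQuotientMap hQ hQs
  -- `ρ` rises to `1` during the first half of the time, and `τ` falls from `1` to `0` during the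
  -- second. At each moment one of them is `1`.
  let ρ : I → I := fun s => ⟨min 1 (2 * s), le_min zero_le_one (by have := s.2.1; positivity),
    min_le_left _ _⟩
  have hρ : Continuous ρ := by
    refine Continuous.subtype_mk ?_ _
    fun_prop
  let τ : I → I := fun s => ρ (unitInterval.symm s)
  have hτ : Continuous τ := hρ.comp unitInterval.continuous_symm
  have hρ0 : ρ 0 = 0 := Subtype.ext (by simp [ρ])
  have hρ1 : ρ 1 = 1 := Subtype.ext (by simp [ρ])
  have hτ0 : τ 0 = 1 := by simp [τ, hρ1]
  have hτ1 : τ 1 = 0 := by simp [τ, hρ0]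
  have hρτ : ∀ s, ρ s = 1 ∨ τ s = 1 := by
    intro s
    rcases le_total (1 / 2 : ℝ) s with hs | hs
    · left
      exact Subtype.ext (min_eq_left (by linarith))
    · right
      refine Subtype.ext (min_eq_left ?_)
      rw [unitInterval.coe_symm_eq]
      linarith
  -- The contraction of the link is run only up to time `t * ρ`, then the coordinate at `x` is
  -- shrunk. On the base, `t = 0`, nothing moves. At the vertex, `t = 1`, the value does not depend
  -- on `y`: either the link has been contracted to `y₀`, or the point is still the vertex.
  let F : (K × I) × I → chainRealization D :=
    fun z => q (h (z.1.2 * ρ z.2, z.1.1), z.1.2 * τ z.2)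
  have hF : Continuous F := by
    refine hq.comp ((h.continuous.comp ?_).prodMk ?_) <;> fun_prop
  let H' : (chainRealization (D \ {x}) × I) ⊕ ((K × I) × I) → chainRealization D :=
    Sum.elim (fun z => incl z.1) F
  have hH' : Continuous H' := (hincl.comp continuous_fst).sumElim hF
  have hmix : ∀ b s z, (incl b, s) = Prod.map q id z → incl b = F z := by
    rintro b s ⟨⟨y, t⟩, s'⟩ hb
    have h1 : incl b = q (y, t) := congrArg Prod.fst hb
    have ht : t = 0 := by
      have := hinclx b
      rw [h1, hqx] at this
      exact Subtype.ext this
    subst ht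
    simp [F, h1]
  have hcompat : ∀ z z', Q z = Q z' → H' z = H' z' := by
    rintro (⟨b, s⟩ | z) (⟨b', s'⟩ | z') hz
    · exact congrArg Prod.fst hz
    · exact hmix b s z' hz
    · exact (hmix b' s' z hz.symm).symm
    · obtain ⟨⟨y, t⟩, s⟩ := z
      obtain ⟨⟨y', t'⟩, s'⟩ := z'
      have hs : s = s' := congrArg Prod.snd hz
      have h1 : q (y, t) = q (y', t') := congrArg Prod.fst hz
      have ht : t = t' := by
        have := congrArg (fun w : chainRealization D => w.1 x) h1
        simp only [hqx] at this
        exact Subtype.ext this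
      subst hs ht
      by_cases ht1 : t = 1
      · subst ht1
        change F _ = F _
        simp only [F, one_mul]
        rcases hρτ s with h2 | h2
        · simp [h2]
        · rw [h2]
          exact Subtype.ext (conePoint_one _ _ _)
      · have hy : y = y' := by
          refine Subtype.ext (funext fun b => ?_)
          have h2 : conePoint x y.1 t b = conePoint x y'.1 t b :=
            congrFun (congrArg Subtype.val h1) b
          have h3 : (1 : ℝ) - t ≠ 0 := fun h3 =>
            ht1 (Subtype.ext (by simpa using (sub_eq_zero.mp h3).symm))
          exact mul_left_cancel₀ h3 (add_left_cancel h2)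
        rw [hy]
  have hlift : ∀ z, H' (Function.surjInv hQs (Q z)) = H' z := fun z =>
    hcompat _ _ (Function.surjInv_eq hQs _)
  refine ⟨⟨fun w => H' (Function.surjInv hQs w), ?_⟩, fun w => ?_, fun w => ?_, fun w s hw => ?_⟩
  · rw [hquot.continuous_iff]
    exact hH'.congr fun z => (hlift z).symm
  · obtain ⟨z, hz⟩ := hQs (w, 0)
    change H' (Function.surjInv hQs (w, 0)) = w
    rw [← hz, hlift]
    rcases z with ⟨b, s⟩ | ⟨⟨y, t⟩, s⟩
    · exact congrArg Prod.fst hz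
    · have hs : s = 0 := congrArg Prod.snd hz
      subst hs
      have h1 : q (y, t) = w := congrArg Prod.fst hz
      simpa [H', F, hρ0, hτ0] using h1
  · obtain ⟨z, hz⟩ := hQs (w, 1)
    change (H' (Function.surjInv hQs (w, 1))).1 x = 0
    rw [← hz, hlift]
    rcases z with ⟨b, s⟩ | ⟨⟨y, t⟩, s⟩
    · exact hinclx b
    · have hs : s = 1 := congrArg Prod.snd hz
      subst hs
      change (q _).1 x = 0
      rw [hqx]
      simp [hτ1]
  · obtain ⟨z, hz⟩ := hQs (w, s)
    change H' (Function.surjInv hQs (w, s)) = w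
    rw [← hz, hlift]
    rcases z with ⟨b, s⟩ | ⟨⟨y, t⟩, s⟩
    · exact congrArg Prod.fst hz
    · have h1 : q (y, t) = w := congrArg Prod.fst hz
      have ht : t = 0 := by
        rw [← h1, hqx] at hw
        exact Subtype.ext hw
      subst ht
      simpa [H', F] using h1

theorem contractibleSpace_of_homotopic_comp {X Y : Type*} [TopologicalSpace X] [TopologicalSpace Y]
    [ContractibleSpace Y] (f : C(X, Y)) (g : C(Y, X))
    (h : (ContinuousMap.id X).Homotopic (g.comp f)) : ContractibleSpace X := by
  rw [contractible_iff_id_nullhomotopic]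
  obtain ⟨y, hy⟩ := ((id_nullhomotopic Y).comp_right g).comp_left f
  exact ⟨y, h.trans (by simpa using hy)⟩

theorem contractibleSpace_of_retract {X Y : Type*} [TopologicalSpace X] [TopologicalSpace Y]
    [ContractibleSpace Y] (f : C(X, Y)) (g : C(Y, X)) (h : ∀ x, g (f x) = x) :
    ContractibleSpace X := by
  refine contractibleSpace_of_homotopic_comp f g ?_
  have : g.comp f = ContinuousMap.id X := ContinuousMap.ext h
  rw [this]

/-- The end of the deformation is a retraction onto the subcomplex without `x`. A retract of a
contractible space is contractible, and conversely the deformation joins the identity to a map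
through the subcomplex. -/
theorem contractibleSpace_diff_singleton_iff {D : Set α} {x : α} (hx : x ∈ D)
    (hL : ContractibleSpace (chainRealization (posetLink D x))) :
    ContractibleSpace (chainRealization (D \ {x})) ↔ ContractibleSpace (chainRealization D) := by
  obtain ⟨H, h0, h1, h2⟩ := exists_deformation_of_contractible_link hx hL
  let incl : C(chainRealization (D \ {x}), chainRealization D) :=
    ⟨Set.inclusion (chainRealization_mono Set.sdiff_subset), continuous_inclusion _⟩
  let r : C(chainRealization D, chainRealization (D \ {x})) :=
    ⟨fun w => ⟨(H (w, 1)).1, (H (w, 1)).2.1, fun a ha => ⟨(H (w, 1)).2.2.1 a ha, by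
      rintro rfl
      exact ha (h1 w)⟩, (H (w, 1)).2.2.2⟩, by
      refine Continuous.subtype_mk ?_ _
      exact continuous_subtype_val.comp (H.continuous.comp (by fun_prop))⟩
  constructor
  · intro _
    refine contractibleSpace_of_homotopic_comp r incl
      ⟨⟨H.comp ContinuousMap.prodSwap, fun w => ?_, fun w => ?_⟩⟩
    · exact h0 w
    · rfl
  · intro _
    refine contractibleSpace_of_retract incl r fun b => Subtype.ext ?_
    exact congrArg (fun w : chainRealization D => w.1)
      (h2 (incl b) 1 (apply_eq_zero_of_notMem (fun h => h.2 rfl) b))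

/-- Elements of `D \ C` whose upper links in `D` are contractible, also after adding any
elements below, can be removed from `D` without changing contractibility. -/
theorem contractibleSpace_chainRealization_iff_of_subset {C D : Set α} (hCD : C ⊆ D)
    (h : ∀ x ∈ D \ C, ∀ L ⊆ Set.Iio x,
      ContractibleSpace (chainRealization (L ∪ {y | y ∈ D ∧ x < y}))) :
    ContractibleSpace (chainRealization C) ↔ ContractibleSpace (chainRealization D) := by
  induction hn : (D \ C).ncard generalizing D with
  | zero =>
    rw [Set.ncard_eq_zero (Set.toFinite _), Set.sdiff_eq_empty] at hn
    rw [hCD.antisymm hn]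
  | succ n ih =>
    have hne : (D \ C).Nonempty := by
      rw [← Set.ncard_pos (Set.toFinite _)]
      omega
    -- Removing a minimal element leaves the upper links of the other elements of `D \ C` unchanged.
    -- Lower links do change, which is why the hypothesis allows an arbitrary `L`.
    obtain ⟨x, hx⟩ := (Set.toFinite (D \ C)).exists_minimal hne
    have hmin : ∀ y ∈ D \ C, ¬ y < x := fun y hy => hx.not_lt hy
    have hx := hx.prop
    rw [ih (D := D \ {x}), contractibleSpace_diff_singleton_iff hx.1]
    · have := h x hx {y | y ∈ D ∧ y < x} fun y hy => hy.2
      have hlink : posetLink D x = {y | y ∈ D ∧ y < x} ∪ {y | y ∈ D ∧ x < y} := by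
        ext y
        simp [posetLink, and_or_left]
      rwa [hlink]
    · exact fun y hy => ⟨hCD hy, by rintro rfl; exact hx.2 hy⟩
    · intro y hy L hL
      have := h y ⟨hy.1.1, hy.2⟩ L hL
      have hup : {z | z ∈ D \ {x} ∧ y < z} = {z | z ∈ D ∧ y < z} := by
        ext z
        simp only [Set.mem_ofPred_eq, Set.mem_sdiff, Set.mem_singleton_iff, and_congr_left_iff,
          and_iff_left_iff_imp]
        rintro hyz - rfl
        exact hmin y ⟨hy.1.1, hy.2⟩ hyz
      rwa [hup]
    · have : (D \ {x}) \ C = (D \ C) \ {x} := by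
        ext y
        simp only [Set.mem_sdiff, Set.mem_singleton_iff]
        tauto
      rw [this, Set.ncard_sdiff_singleton_of_mem hx, hn, Nat.add_sub_cancel]

/-! ### Contractibility through zigzags of monotone maps -/

theorem chainMap_const_homotopic {C D : Set α} {a : α} (ha : Set.MapsTo (fun _ => a) C D)
    (hm : MonotoneOn (fun _ => a) C) (haD : a ∈ D) :
    (chainMap (fun _ => a) ha hm).Nullhomotopic := by
  classical
  have hmem : (fun b => if a = b then (1 : ℝ) else 0) ∈ chainRealization D := by
    refine ⟨fun b => ?_, fun b hb => ?_, fun b c hb hc => ?_, ?_⟩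
    · dsimp only
      split_ifs <;> norm_num
    · have : a = b := by simpa using hb
      exact this ▸ haD
    · have h1 : a = b := by simpa using hb
      have h2 : a = c := by simpa using hc
      exact Or.inl (h1 ▸ h2 ▸ le_rfl)
    · simp
  refine ⟨⟨_, hmem⟩, ?_⟩
  have : chainMap (fun _ => a) ha hm = ContinuousMap.const _ ⟨_, hmem⟩ := by
    ext w b
    change ∑ c, (if a = b then w.1 c else 0) = if a = b then (1 : ℝ) else 0
    split_ifs
    · exact w.2.2.2.2
    · simp
  rw [this]

theorem chainMap_homotopic_id {C : Set α} {f : α → α} (hf : Set.MapsTo f C C)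
    (hfm : MonotoneOn f C) (h : (∀ a ∈ C, f a ≤ a) ∨ ∀ a ∈ C, a ≤ f a) :
    (chainMap f hf hfm).Homotopic (ContinuousMap.id _) := by
  have : chainMap id (Set.mapsTo_id C) monotoneOn_id = ContinuousMap.id (chainRealization C) :=
    ContinuousMap.ext fun w => Subtype.ext (chainMap_id id _ _ (fun _ _ => rfl) w)
  rw [← this]
  rcases h with h | h
  · exact chainMap_homotopic _ _ _ _ h
  · exact (chainMap_homotopic _ _ _ _ h).symm

/-- A poset is contractible if the zigzag `id ≥ f ≤ g ≥ a` of monotone maps connects its identity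
to a constant map. -/
theorem contractibleSpace_of_zigzag {C : Set α} {f g : α → α} {a : α} (hf : Set.MapsTo f C C)
    (hfm : MonotoneOn f C) (hg : Set.MapsTo g C C) (hgm : MonotoneOn g C)
    (hfid : ∀ b ∈ C, f b ≤ b) (hfg : ∀ b ∈ C, f b ≤ g b) (ha : a ∈ C) (hag : ∀ b ∈ C, a ≤ g b) :
    ContractibleSpace (chainRealization C) := by
  rw [contractible_iff_id_nullhomotopic]
  have ha' : Set.MapsTo (fun _ => a) C C := fun _ _ => ha
  obtain ⟨y, hy⟩ := chainMap_const_homotopic ha' monotoneOn_const ha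
  exact ⟨y, (chainMap_homotopic_id hf hfm (Or.inl hfid)).symm.trans <|
    (chainMap_homotopic hf hfm hg hgm hfg).trans <|
    (chainMap_homotopic ha' monotoneOn_const hg hgm hag).symm.trans hy⟩

/-- The join of a subset `L` below `x` with a conically contractible set `U` above `x` is
contractible. -/
theorem contractibleSpace_union_of_zigzag {L U : Set α} {x a : α} {f g : α → α}
    (hL : L ⊆ Set.Iio x) (hU : U ⊆ Set.Ioi x) (hf : Set.MapsTo f U U) (hfm : MonotoneOn f U)
    (hg : Set.MapsTo g U U) (hgm : MonotoneOn g U) (hfid : ∀ b ∈ U, f b ≤ b)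
    (hfg : ∀ b ∈ U, f b ≤ g b) (ha : a ∈ U) (hag : ∀ b ∈ U, a ≤ g b) :
    ContractibleSpace (chainRealization (L ∪ U)) := by
  classical
  have hLU : ∀ b ∈ L, ∀ c ∈ U, b < c := fun b hb c hc => lt_trans (hL hb) (hU hc)
  have hdisj : ∀ b ∈ L, b ∉ U := fun b hb hc => lt_irrefl b (hLU b hb b hc)
  -- Self-maps of `U` are extended by the identity on `L`, which preserves monotonicity because `L`
  -- lies below `U`. Once `U` has been collapsed to `a`, all of `L` lies below `a` and can be moved
  -- there too.
  let e : (α → α) → α → α := fun k b => if b ∈ U then k b else b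
  have emaps : ∀ k, Set.MapsTo k U U → Set.MapsTo (e k) (L ∪ U) (L ∪ U) := by
    intro k hk b hb
    by_cases hbU : b ∈ U
    · simpa [e, hbU] using Or.inr (hk hbU)
    · simpa [e, hbU] using hb
  have emono : ∀ k, Set.MapsTo k U U → MonotoneOn k U → MonotoneOn (e k) (L ∪ U) := by
    intro k hk hkm b hb c hc hbc
    rcases hb with hb | hb <;> rcases hc with hc | hc
    · simpa [e, hdisj b hb, hdisj c hc] using hbc
    · simpa [e, hdisj b hb, hc] using (hLU b hb _ (hk hc)).le
    · exact absurd (hLU c hc b hb) hbc.not_gt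
    · simpa [e, hb, hc] using hkm hb hc hbc
  have ele : ∀ k k' : α → α, (∀ b ∈ U, k b ≤ k' b) → ∀ b ∈ L ∪ U, e k b ≤ e k' b := by
    intro k k' hk b _
    by_cases hbU : b ∈ U
    · simpa [e, hbU] using hk b hbU
    · simp [e, hbU]
  have hcm : Set.MapsTo (fun _ => a) U U := fun _ _ => ha
  have hk := chainMap_homotopic (emaps _ hcm) (emono _ hcm monotoneOn_const) (emaps g hg)
    (emono g hg hgm) (ele _ _ hag)
  have hca : Set.MapsTo (fun _ => a) (L ∪ U) (L ∪ U) := fun _ _ => Or.inr ha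
  have hka := chainMap_homotopic (emaps _ hcm) (emono _ hcm monotoneOn_const) hca
    monotoneOn_const (by
      rintro b (hb | hb)
      · simpa [e, hdisj b hb] using (hLU b hb a ha).le
      · simp [e, hb])
  have hfe := chainMap_homotopic (emaps f hf) (emono f hf hfm) (emaps g hg) (emono g hg hgm)
    (ele _ _ hfg)
  have hid := chainMap_homotopic_id (emaps f hf) (emono f hf hfm) (Or.inl (by
    intro b hb
    by_cases hbU : b ∈ U
    · simpa [e, hbU] using hfid b hbU
    · simp [e, hbU]))
  obtain ⟨y, hy⟩ := chainMap_const_homotopic hca monotoneOn_const (Or.inr ha)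
  rw [contractible_iff_id_nullhomotopic]
  exact ⟨y, hid.symm.trans <| hfe.trans <| hk.symm.trans <| hka.trans hy⟩

/-- If `D` is contractible, `D ⊆ C`, and `C` has a monotone increasing map to `D`, then `C` is
contractible. -/
theorem contractibleSpace_of_le_map {C D : Set α} (hDC : D ⊆ C) {f : α → α}
    (hf : Set.MapsTo f C D) (hfm : MonotoneOn f C) (hle : ∀ b ∈ C, b ≤ f b)
    (hD : ContractibleSpace (chainRealization D)) : ContractibleSpace (chainRealization C) := by
  let incl : C(chainRealization D, chainRealization C) :=
    ⟨Set.inclusion (chainRealization_mono hDC), continuous_inclusion _⟩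
  exact contractibleSpace_of_homotopic_comp (chainMap f hf hfm) incl
    (chainMap_homotopic_id (fun b hb => hDC (hf hb)) hfm (Or.inr hle)).symm

theorem sum_univ_eq_sum_subtype {α : Type*} [Fintype α] (C : Set α) [Fintype C] (f : α → ℝ)
    (hf : ∀ a, a ∉ C → f a = 0) : ∑ a, f a = ∑ a : C, f a := by
  classical
  rw [← Finset.sum_subset (Finset.subset_univ C.toFinset) fun a _ ha => hf a (by simpa using ha)]
  exact Finset.sum_subtype _ (fun a => Set.mem_toFinset) f

/-- The realization of the order complex of a subset in ambient barycentric coordinates is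
homeomorphic to the geometric realization of its order complex. -/
noncomputable def geomRealizationHomeomorph (C : Set α) :
    geomRealization (orderComplex C) ≃ₜ chainRealization C := by
  classical
  exact
  { toFun := fun w => ⟨fun a => if h : a ∈ C then w.1 ⟨a, h⟩ else 0, by
      obtain ⟨h0, s, ⟨-, hs⟩, hsw, hsum⟩ := w.2
      have hmem : ∀ a, w.1 a ≠ 0 → a ∈ s := fun a ha => by_contra fun h => ha (hsw a h)
      refine ⟨fun a => ?_, fun a ha => ?_, fun a b ha hb => ?_, ?_⟩
      · dsimp only
        split_ifs
        exacts [h0 _, le_rfl]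
      · by_contra h
        simp [h] at ha
      · have haC : a ∈ C := by
          by_contra h
          simp [h] at ha
        have hbC : b ∈ C := by
          by_contra h
          simp [h] at hb
        simp only [haC, hbC, dif_pos] at ha hb
        exact hs.total (hmem _ ha) (hmem _ hb)
      · rw [← hsum, Finset.sum_subset (Finset.subset_univ s) fun a _ ha => hsw a ha,
          sum_univ_eq_sum_subtype C _ fun a ha => dif_neg ha]
        exact Finset.sum_congr rfl fun a _ => dif_pos a.2⟩
    invFun := fun w => ⟨fun a => w.1 a, by
      refine ⟨fun a => w.2.1 a, Finset.univ.filter fun a : C => w.1 a ≠ 0, ⟨?_, ?_⟩, ?_, ?_⟩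
      · by_contra hne
        rw [Finset.not_nonempty_iff_eq_empty, Finset.filter_eq_empty_iff] at hne
        have := w.2.2.2.2
        rw [sum_univ_eq_sum_subtype C _ fun a ha => apply_eq_zero_of_notMem ha w,
          Finset.sum_eq_zero fun a ha => not_not.mp (hne ha)] at this
        exact zero_ne_one this
      · intro a ha b hb _
        exact w.2.2.2.1 a b (by simpa using ha) (by simpa using hb)
      · intro a ha
        simpa using ha
      · rw [Finset.sum_filter_ne_zero,
          ← sum_univ_eq_sum_subtype C w.1 fun a ha => apply_eq_zero_of_notMem ha w, w.2.2.2.2]⟩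
    left_inv := fun w => Subtype.ext (funext fun a => by simp)
    right_inv := fun w => Subtype.ext (funext fun a => by
      by_cases h : a ∈ C
      · simp [h]
      · simp [h, apply_eq_zero_of_notMem h w])
    continuous_toFun := by
      refine Continuous.subtype_mk (continuous_pi fun a => ?_) _
      split_ifs
      · exact (continuous_apply _).comp continuous_subtype_val
      · exact continuous_const
    continuous_invFun := by
      refine Continuous.subtype_mk (continuous_pi fun a => ?_) _
      exact (continuous_apply _).comp continuous_subtype_val }

end Removal

/-! ### Characteristic `p` and coprime action -/

section GroupTheory

open Subgroup

variable {G : Type*} [Group G] {p : ℕ}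

/-- `O_p(K)` as a subgroup of the ambient group. -/
def coreIn (p : ℕ) (K : Subgroup G) : Subgroup G := (pCore p K).map K.subtype

theorem coreIn_le (K : Subgroup G) : coreIn p K ≤ K := map_subtype_le _

theorem isPGroup_coreIn [Finite G] (K : Subgroup G) : IsPGroup p (coreIn p K) :=
  (pCore_isGreatest p K).1.2.map _

theorem le_coreIn {N K : Subgroup G} (hNK : N ≤ K) (hK : K ≤ normalizer (N : Set G))
    (hN : IsPGroup p N) : N ≤ coreIn p K := by
  have h1 : N.subgroupOf K ≤ pCore p K := le_sSup
    ⟨(normal_subgroupOf_iff_le_normalizer hNK).mpr hK,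
      hN.of_equiv (subgroupOfEquivOfLe hNK).symm⟩
  have h2 := map_mono (f := K.subtype) h1
  rwa [map_subgroupOf_eq_of_le hNK] at h2

theorem le_normalizer_coreIn [Finite G] (K : Subgroup G) :
    K ≤ normalizer (coreIn p K : Set G) := by
  rw [le_normalizer_iff]
  rintro g hg _ ⟨n, hn, rfl⟩
  exact ⟨⟨g, hg⟩ * n * ⟨g, hg⟩⁻¹, (pCore_isGreatest p K).1.1.conj_mem n hn ⟨g, hg⟩, rfl⟩

theorem normalizer_le_normalizer_coreIn [Finite G] (K : Subgroup G) :
    normalizer (K : Set G) ≤ normalizer (coreIn p K : Set G) := by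
  rw [le_normalizer_iff]
  intro g hg n hn
  have hle : (coreIn p K).map (MulAut.conj g).toMonoidHom ≤ coreIn p K := by
    refine le_coreIn ?_ ?_ ((isPGroup_coreIn K).map _)
    · rintro _ ⟨m, hm, rfl⟩
      exact (mem_normalizer_iff.mp hg m).mp (coreIn_le K hm)
    · rw [le_normalizer_iff]
      rintro k hk _ ⟨m, hm, rfl⟩
      have hk' := (mem_normalizer_iff''.mp hg k).mp hk
      refine ⟨_, le_normalizer_iff.mp (le_normalizer_coreIn K) _ hk' m hm, ?_⟩
      simp [mul_assoc]
  exact hle ⟨n, hn, rfl⟩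

theorem normalizer_le_normalizer_centralizer (K : Subgroup G) :
    normalizer (K : Set G) ≤ normalizer (centralizer (K : Set G) : Set G) := by
  rw [le_normalizer_iff]
  intro g hg c hc
  rw [mem_centralizer_iff] at hc ⊢
  intro k hk
  have h := hc _ ((mem_normalizer_iff''.mp hg k).mp hk)
  calc k * (g * c * g⁻¹) = g * (g⁻¹ * k * g * c) * g⁻¹ := by group
    _ = g * c * g⁻¹ * k := by rw [h]; group

theorem hasCharacteristicP_iff {K : Subgroup G} :
    HasCharacteristicP p K ↔ K ⊓ centralizer (coreIn p K : Set G) ≤ coreIn p K := by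
  constructor
  · rintro h d ⟨hdK, hd⟩
    refine ⟨⟨d, hdK⟩, h ?_, rfl⟩
    rw [mem_centralizer_iff]
    intro k hk
    exact Subtype.ext (mem_centralizer_iff.mp hd k ⟨k, hk, rfl⟩)
  · intro h d hd
    have : (d : G) ∈ coreIn p K := by
      refine h (mem_inf.mpr ⟨d.2, ?_⟩)
      rw [mem_centralizer_iff]
      rintro _ ⟨k, hk, rfl⟩
      exact congrArg Subtype.val (mem_centralizer_iff.mp hd k hk)
    obtain ⟨e, he, hed⟩ := this
    rwa [← Subtype.ext hed]

/-- If `d` centralizes the commutator of `r` with `d`, and this is a `p`-element, while `d` has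
order prime to `p`, then `d` centralizes `r`. -/
theorem commute_of_commute_commutator {d r : G} (hd : (orderOf d).Coprime p)
    (hc : ∃ k, (r⁻¹ * d * r * d⁻¹) ^ p ^ k = 1) (h : Commute d (r⁻¹ * d * r * d⁻¹)) :
    Commute d r := by
  set c := r⁻¹ * d * r * d⁻¹ with hcdef
  have hdr : d * r = r * c * d := by rw [hcdef]; group
  -- For `n` the order of `d` this yields `c ^ n = 1`, so `c` has order both prime to `p` and a
  -- power of `p`.
  have key : ∀ n : ℕ, d ^ n * r = r * c ^ n * d ^ n := by
    intro n
    induction n with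
    | zero => simp
    | succ n ih =>
      calc d ^ (n + 1) * r = d * (d ^ n * r) := by rw [pow_succ', mul_assoc]
        _ = (d * r) * c ^ n * d ^ n := by rw [ih]; simp only [mul_assoc]
        _ = r * c * (d * c ^ n) * d ^ n := by rw [hdr]; simp only [mul_assoc]
        _ = r * c * (c ^ n * d) * d ^ n := by rw [(h.pow_right n).eq]
        _ = r * c ^ (n + 1) * d ^ (n + 1) := by simp only [pow_succ', mul_assoc]
  have h1 : c ^ orderOf d = 1 := by simpa [pow_orderOf_eq_one] using key (orderOf d)
  obtain ⟨k, hk⟩ := hc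
  have h2 : orderOf c = 1 := Nat.eq_one_of_dvd_coprimes (hd.pow_right k)
    (orderOf_dvd_of_pow_eq_one h1) (orderOf_dvd_of_pow_eq_one hk)
  rw [orderOf_eq_one_iff] at h2
  rw [h2, mul_one] at hdr
  exact hdr

theorem eq_one_of_mem_of_coprime {A : Subgroup G} (hA : IsPGroup p A) {d : G} (hdA : d ∈ A)
    (hd : (orderOf d).Coprime p) : d = 1 := by
  obtain ⟨k, hk⟩ := hA ⟨d, hdA⟩
  have hk' : d ^ p ^ k = 1 := congrArg Subtype.val hk
  rw [← orderOf_eq_one_iff]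
  exact Nat.eq_one_of_dvd_coprimes (hd.pow_right k) dvd_rfl (orderOf_dvd_of_pow_eq_one hk')

theorem isPGroup_of_forall_coprime [Finite G] [Fact p.Prime] {D : Subgroup G}
    (h : ∀ d ∈ D, (orderOf d).Coprime p → d = 1) : IsPGroup p D := by
  intro d
  obtain ⟨k, m, hm, hk⟩ := Nat.exists_eq_pow_mul_and_not_dvd (orderOf_pos (d : G)).ne' p
    (Fact.out : p.Prime).ne_one
  refine ⟨k, Subtype.ext (h ((d : G) ^ p ^ k) (pow_mem d.2 _) ?_)⟩
  have hpk : p ^ k ≠ 0 := pow_ne_zero _ (Fact.out : p.Prime).ne_zero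
  rw [orderOf_pow_of_dvd hpk (hk ▸ dvd_mul_right _ _), hk,
    Nat.mul_div_cancel_left _ (Nat.pos_of_ne_zero hpk)]
  exact ((Fact.out : p.Prime).coprime_iff_not_dvd.mpr hm).symm

/-- To show that `K` has characteristic `p` it suffices to show that the elements of order prime
to `p` that centralize `O_p(K)` are trivial. -/
theorem hasCharacteristicP_of_forall_coprime [Finite G] [Fact p.Prime] {K : Subgroup G}
    (h : ∀ d ∈ K, d ∈ centralizer (coreIn p K : Set G) → (orderOf d).Coprime p → d = 1) :
    HasCharacteristicP p K := by
  rw [hasCharacteristicP_iff]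
  -- `C_K(O_p(K))` is normalized by `K`; without nontrivial `p'`-elements it is a `p`-group, hence
  -- inside `O_p(K)`.
  refine le_coreIn inf_le_left ?_ (isPGroup_of_forall_coprime fun d hd => h d hd.1 hd.2)
  refine le_trans (le_inf le_normalizer ?_) inf_normalizer_le_normalizer_inf
  exact (le_normalizer_coreIn K).trans (normalizer_le_normalizer_centralizer _)

/-- A `p'`-element `d` of `K` centralizing `O_p(K)` has its commutators with `O_p(H)` in `O_p(H) ⊓ K
≤ O_p(K)`, so it centralizes them. By coprime action `d` centralizes `O_p(H)`, hence lies in it and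
is trivial. -/
theorem HasCharacteristicP.of_normal [Finite G] [Fact p.Prime] {H K : Subgroup G}
    (hH : HasCharacteristicP p H) (hKH : K ≤ H) (hHK : H ≤ normalizer (K : Set G)) :
    HasCharacteristicP p K := by
  rw [hasCharacteristicP_iff] at hH
  refine hasCharacteristicP_of_forall_coprime fun d hdK hd hcop => ?_
  have hAK : coreIn p H ⊓ K ≤ coreIn p K := by
    refine le_coreIn inf_le_right ?_ ((isPGroup_coreIn H).to_le inf_le_left)
    exact le_trans (le_inf (hKH.trans (le_normalizer_coreIn H)) le_normalizer)
      inf_normalizer_le_normalizer_inf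
  refine eq_one_of_mem_of_coprime (isPGroup_coreIn H) (hH (mem_inf.mpr ⟨hKH hdK, ?_⟩)) hcop
  rw [mem_centralizer_iff]
  intro a ha
  have hcA : a⁻¹ * d * a * d⁻¹ ∈ coreIn p H := by
    have := mul_mem (inv_mem ha) (le_normalizer_iff.mp (le_normalizer_coreIn H) d (hKH hdK) a ha)
    simpa only [mul_assoc] using this
  have hcK : a⁻¹ * d * a * d⁻¹ ∈ K :=
    mul_mem ((mem_normalizer_iff''.mp (hHK (coreIn_le H ha)) d).mp hdK) (inv_mem hdK)
  have hc := hAK ⟨hcA, hcK⟩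
  refine (commute_of_commute_commutator hcop ?_ ?_).eq.symm
  · obtain ⟨k, hk⟩ := isPGroup_coreIn H ⟨_, hcA⟩
    exact ⟨k, congrArg Subtype.val hk⟩
  · exact (mem_centralizer_iff.mp hd _ hc).symm

theorem lt_inf_normalizer_of_lt [Finite G] [Fact p.Prime] {F R : Subgroup G} (hR : IsPGroup p R)
    (h : F < R) : F < R ⊓ normalizer (F : Set G) := by
  have hnil : Group.IsNilpotent R := hR.isNilpotent
  have h1 : F.subgroupOf R < ⊤ := by
    rw [lt_top_iff_ne_top, Ne, subgroupOf_eq_top]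
    exact h.not_ge
  have h2 := Group.normalizerCondition_of_isNilpotent (G := R) _ h1
  refine lt_of_le_of_ne (le_inf h.le le_normalizer) fun heq => h2.not_ge ?_
  intro r hr
  rw [mem_subgroupOf]
  rw [heq]
  refine ⟨r.2, mem_normalizer_iff.mpr fun f => ?_⟩
  constructor
  · intro hf
    exact (mem_normalizer_iff.mp hr ⟨f, h.le hf⟩).mp hf
  · intro hf
    have hfR : f ∈ R := by
      have := R.mul_mem (R.mul_mem (R.inv_mem r.2) (h.le hf)) r.2
      simpa [mul_assoc] using this
    exact (mem_normalizer_iff.mp hr ⟨f, hfR⟩).mpr hf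

/-- A form of Thompson's `P × Q`-lemma: an element of order prime to `p` that normalizes a
`p`-group `R` and centralizes a subgroup `Q` of `R` as well as `C_R(Q)` centralizes `R`. -/
theorem mem_centralizer_of_centralizes_centralizer [Finite G] [Fact p.Prime] {Q R : Subgroup G}
    {d : G} (hR : IsPGroup p R) (hQR : Q ≤ R) (hd : (orderOf d).Coprime p)
    (hdR : d ∈ normalizer (R : Set G)) (hdQ : d ∈ centralizer (Q : Set G))
    (hdC : d ∈ centralizer ((R ⊓ centralizer (Q : Set G) : Subgroup G) : Set G)) :
    d ∈ centralizer (R : Set G) := by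
  set F := R ⊓ centralizer {d} with hF
  have hQF : Q ≤ F := by
    refine le_inf hQR fun x hx => ?_
    rw [mem_centralizer_singleton_iff]
    exact mem_centralizer_iff.mp hdQ x hx
  have hFR : F = R := by
    by_contra hne
    -- For `r` in `N_R(F)` outside `F = C_R(d)`, both `d` and its conjugate `r⁻¹ * d * r` centralize
    -- `Q`. Their quotient lies in `C_R(Q)`, so `d` commutes with it and hence with `r`, a
    -- contradiction.
    obtain ⟨r, hr, hrF⟩ := SetLike.exists_of_lt
      (lt_inf_normalizer_of_lt hR (lt_of_le_of_ne inf_le_left hne))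
    obtain ⟨hrR, hrN⟩ := mem_inf.mp hr
    refine hrF (mem_inf.mpr ⟨hrR, ?_⟩)
    have hcR : r⁻¹ * d * r * d⁻¹ ∈ R := by
      have := mul_mem (inv_mem hrR) ((mem_normalizer_iff.mp hdR r).mp hrR)
      simpa only [mul_assoc] using this
    have hcF : r⁻¹ * d * r * d⁻¹ ∈ centralizer (Q : Set G) := by
      rw [mem_centralizer_iff]
      intro f hf
      have h1 : f * d = d * f := mem_centralizer_iff.mp hdQ f hf
      have h2 : (r * f * r⁻¹) * d = d * (r * f * r⁻¹) :=
        mem_centralizer_singleton_iff.mp ((mem_normalizer_iff.mp hrN f).mp (hQF hf)).2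
      have h3 : d⁻¹ * f = f * d⁻¹ := by
        rw [inv_mul_eq_iff_eq_mul, ← mul_assoc, ← h1, mul_inv_cancel_right]
      calc f * (r⁻¹ * d * r * d⁻¹) = r⁻¹ * (r * f * r⁻¹ * d) * r * d⁻¹ := by group
        _ = r⁻¹ * d * r * (f * d⁻¹) := by rw [h2]; group
        _ = r⁻¹ * d * r * d⁻¹ * f := by rw [← h3]; group
    rw [mem_centralizer_singleton_iff]
    refine (commute_of_commute_commutator hd ?_ ?_).eq.symm
    · obtain ⟨k, hk⟩ := hR ⟨_, hcR⟩
      exact ⟨k, congrArg Subtype.val hk⟩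
    · exact (mem_centralizer_iff.mp hdC _ ⟨hcR, hcF⟩).symm
  rw [mem_centralizer_iff]
  intro r hr
  rw [SetLike.mem_coe, ← hFR] at hr
  exact mem_centralizer_singleton_iff.mp hr.2

/-- With `A = O_p(C_G(Q))`, the `P × Q` lemma is applied to the `p`-group `A Q₁` and its subgroup
`Q₁`. A `p'`-element of `C_G(Q₁)` centralizing `O_p(C_G(Q₁))` centralizes `A Q₁ ⊓ C_G(Q₁)`, hence
`A`, and so is trivial. -/
theorem HasCharacteristicP.centralizer_of_le_normalizer [Finite G] [Fact p.Prime]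
    {Q Q₁ : Subgroup G} (hQ : HasCharacteristicP p (centralizer (Q : Set G))) (hle : Q ≤ Q₁)
    (hnorm : Q₁ ≤ normalizer (Q : Set G)) (hQ₁ : IsPGroup p Q₁) :
    HasCharacteristicP p (centralizer (Q₁ : Set G)) := by
  rw [hasCharacteristicP_iff] at hQ
  set H := centralizer (Q : Set G)
  set K := centralizer (Q₁ : Set G)
  set A := coreIn p H
  have hKH : K ≤ H := centralizer_le hle
  have hQA : Q₁ ≤ normalizer (A : Set G) := hnorm.trans
    ((normalizer_le_normalizer_centralizer Q).trans (normalizer_le_normalizer_coreIn _))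
  have hR : IsPGroup p (A ⊔ Q₁ : Subgroup G) := (isPGroup_coreIn H).to_sup_of_normal_left' hQ₁ hQA
  have hKR : K ≤ normalizer ((A ⊔ Q₁ : Subgroup G) : Set G) := le_trans
    (le_inf (hKH.trans (le_normalizer_coreIn H)) (centralizer_le_normalizer _))
    (normalizer_inf_normalizer_le_normalizer_sup _ _)
  refine hasCharacteristicP_of_forall_coprime fun d hdK hd hcop => ?_
  refine eq_one_of_mem_of_coprime (isPGroup_coreIn H) (hQ (mem_inf.mpr ⟨hKH hdK, ?_⟩)) hcop
  have hRK : (A ⊔ Q₁) ⊓ K ≤ coreIn p K := le_coreIn inf_le_right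
    (le_trans (le_inf hKR le_normalizer) inf_normalizer_le_normalizer_inf) (hR.to_le inf_le_left)
  have := mem_centralizer_of_centralizes_centralizer hR le_sup_right hcop (hKR hdK) hdK
    (centralizer_le hRK hd)
  exact centralizer_le (SetLike.coe_subset_coe.mpr le_sup_left) this

/-- Normalizers grow in `p`-groups, so a maximal subgroup of `P` with the property must be `P`
itself. -/
theorem HasCharacteristicP.centralizer_of_le [Finite G] [Fact p.Prime] {Q P : Subgroup G}
    (hQ : HasCharacteristicP p (centralizer (Q : Set G))) (hQP : Q ≤ P) (hP : IsPGroup p P) :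
    HasCharacteristicP p (centralizer (P : Set G)) := by
  obtain ⟨M, -, hM⟩ := (Set.toFinite {R : Subgroup G | R ≤ P ∧
    HasCharacteristicP p (centralizer (R : Set G))}).exists_le_maximal ⟨hQP, hQ⟩
  by_cases hMP : M = P
  · rw [← hMP]
    exact hM.prop.2
  · have hlt := lt_inf_normalizer_of_lt hP (lt_of_le_of_ne hM.prop.1 hMP)
    exact absurd hlt (hM.not_gt ⟨inf_le_left, hM.prop.2.centralizer_of_le_normalizer hlt.le
      inf_le_right (hP.to_le inf_le_left)⟩)

/-! ### Distinguished `p`-subgroups and parabolic characteristic `p` -/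

theorem mem_centerOf_iff {P : Subgroup G} {x : G} :
    x ∈ centerOf P ↔ x ∈ P ∧ ∀ y ∈ P, y * x = x * y := by
  constructor
  · rintro ⟨z, hz, rfl⟩
    refine ⟨z.2, fun y hy => ?_⟩
    exact congrArg Subtype.val (mem_center_iff.mp hz ⟨y, hy⟩)
  · rintro ⟨hx, h⟩
    exact ⟨⟨x, hx⟩, mem_center_iff.mpr fun y => Subtype.ext (h y y.2), rfl⟩

theorem mem_distinguishedBrown_iff [Fact p.Prime] {P : Subgroup G} :
    P ∈ distinguishedBrown p G ↔
      IsPGroup p P ∧ ∃ z ∈ P, (∀ y ∈ P, y * z = z * y) ∧ IsPCentral p z := by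
  constructor
  · rintro ⟨⟨hP, -⟩, hne⟩
    refine ⟨hP, ?_⟩
    by_contra hno
    refine hne (closure_eq_bot_iff.mpr ?_)
    rintro x ⟨hx, hxp⟩
    have hle : omegaOne p (centerOf P) ≤ centerOf P := (closure_le _).mpr fun y hy => hy.1
    exact absurd ⟨x, (mem_centerOf_iff.mp (hle hx)).1, (mem_centerOf_iff.mp (hle hx)).2, hxp⟩ hno
  · rintro ⟨hP, z, hz, hcomm, hzp⟩
    have hz1 : z ≠ 1 := by
      rintro rfl
      exact (Fact.out : p.Prime).ne_one (hzp.1.symm.trans orderOf_one)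
    refine ⟨⟨hP, fun h => hz1 ?_⟩, fun h => hz1 ?_⟩
    · rwa [h, mem_bot] at hz
    · have : z ∈ hatSubgroup p P := subset_closure ⟨subset_closure
        ⟨mem_centerOf_iff.mpr ⟨hz, hcomm⟩, hzp.1 ▸ pow_orderOf_eq_one z⟩, hzp⟩
      rwa [h, mem_bot] at this

theorem mem_tildeBrown_iff [Fact p.Prime] {P : Subgroup G} :
    P ∈ tildeBrown p G ↔ IsPGroup p P ∧ ∃ z ∈ P, IsPCentral p z := by
  refine ⟨fun h => ⟨h.1.1, h.2⟩, fun h => ⟨⟨h.1, ?_⟩, h.2⟩⟩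
  rintro rfl
  obtain ⟨z, hz, hzp⟩ := h.2
  rw [mem_bot] at hz
  subst hz
  exact (Fact.out : p.Prime).ne_one (hzp.1.symm.trans orderOf_one)

theorem distinguishedBrown_subset_tildeBrown [Fact p.Prime] :
    distinguishedBrown p G ⊆ tildeBrown p G := by
  intro P hP
  rw [mem_distinguishedBrown_iff] at hP
  obtain ⟨h, z, hz, -, hzp⟩ := hP
  exact mem_tildeBrown_iff.mpr ⟨h, z, hz, hzp⟩

theorem tildeBrown_of_le [Fact p.Prime] {P R : Subgroup G} (hP : P ∈ tildeBrown p G) (h : P ≤ R)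
    (hR : IsPGroup p R) : R ∈ tildeBrown p G := by
  obtain ⟨z, hz, hzp⟩ := hP.2
  exact mem_tildeBrown_iff.mpr ⟨hR, z, h hz, hzp⟩

/-- Self-centralizing `p`-subgroups are distinguished: they contain the center of a Sylow
`p`-subgroup. -/
theorem mem_distinguishedBrown_of_centralizer_le [Finite G] [Fact p.Prime] (hpG : p ∣ Nat.card G)
    {R : Subgroup G} (hR : IsPGroup p R) (h : centralizer (R : Set G) ≤ R) :
    R ∈ distinguishedBrown p G := by
  obtain ⟨S, hRS⟩ := hR.exists_le_sylow
  have hS : Nontrivial S := by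
    rw [nontrivial_iff_ne_bot]
    exact S.ne_bot_of_dvd_card hpG
  have hZ : Nontrivial (center S) := S.isPGroup'.center_nontrivial
  obtain ⟨n, hn, hcard⟩ := (S.isPGroup'.to_subgroup (center S)).nontrivial_iff_card.mp hZ
  obtain ⟨z, hz⟩ := exists_prime_orderOf_dvd_card' (G := center S) p
    (hcard ▸ dvd_pow_self p hn.ne')
  have hzS : ((z : S) : G) ∈ centerOf (S : Subgroup G) := ⟨z, z.2, rfl⟩
  have hcomm := (mem_centerOf_iff.mp hzS).2
  have hzR : ((z : S) : G) ∈ R := h (mem_centralizer_iff.mpr fun y hy => hcomm y (hRS hy))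
  refine mem_distinguishedBrown_iff.mpr ⟨hR, _, hzR, fun y hy => hcomm y (hRS hy), ?_, S, hzS⟩
  rw [orderOf_coe, orderOf_coe, hz]

theorem HasParabolicCharacteristicP.centralizer_zpowers [Finite G] [Fact p.Prime]
    (hG : HasParabolicCharacteristicP p G) {z : G} (hz : IsPCentral p z) :
    HasCharacteristicP p (centralizer (zpowers z : Set G)) := by
  obtain ⟨hzp, S, hzS⟩ := hz
  refine HasCharacteristicP.of_normal (H := normalizer (zpowers z : Set G)) (hG _ ?_ ?_)
    (centralizer_le_normalizer _) (normalizer_le_normalizer_centralizer _)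
  · refine ⟨zpowers z, S.isPGroup'.to_le ?_, ?_, rfl⟩
    · rw [zpowers_le]
      exact (mem_centerOf_iff.mp hzS).1
    · rw [Ne, zpowers_eq_bot]
      rintro rfl
      exact (Fact.out : p.Prime).ne_one (hzp.symm.trans orderOf_one)
  · refine ⟨S, le_trans ?_ (centralizer_le_normalizer _)⟩
    intro s hs
    rw [mem_centralizer_iff]
    rintro _ ⟨n, rfl⟩
    exact (Commute.zpow_right ((mem_centerOf_iff.mp hzS).2 s hs) n).eq.symm

theorem HasParabolicCharacteristicP.centralizer_of_mem_tildeBrown [Finite G] [Fact p.Prime]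
    (hG : HasParabolicCharacteristicP p G) {P : Subgroup G} (hP : P ∈ tildeBrown p G) :
    HasCharacteristicP p (centralizer (P : Set G)) := by
  obtain ⟨z, hz, hzp⟩ := hP.2
  exact (hG.centralizer_zpowers hzp).centralizer_of_le (zpowers_le.mpr hz) hP.1.1

theorem le_coreIn_normalizer {P : Subgroup G} (hP : IsPGroup p P) :
    P ≤ coreIn p (normalizer (P : Set G)) :=
  le_coreIn le_normalizer le_rfl hP

theorem dvd_card_of_mem_tildeBrown {P : Subgroup G} (hP : P ∈ tildeBrown p G) :
    p ∣ Nat.card G := by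
  obtain ⟨z, -, hzp⟩ := hP.2
  exact hzp.1 ▸ orderOf_dvd_natCard z

/-- The group `O_p(N_G(P))` contains both `P` and `O_p(C_G(P))`. What centralizes it therefore lies
in `C_G(P)` and centralizes `O_p(C_G(P))`, so lies in `O_p(C_G(P))` by characteristic `p`. -/
theorem coreIn_normalizer_mem_distinguishedBrown [Finite G] [Fact p.Prime]
    (hG : HasParabolicCharacteristicP p G) {P : Subgroup G} (hP : P ∈ tildeBrown p G) :
    coreIn p (normalizer (P : Set G)) ∈ distinguishedBrown p G := by
  have hPO := le_coreIn_normalizer hP.1.1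
  have hC := hasCharacteristicP_iff.mp (hG.centralizer_of_mem_tildeBrown hP)
  have hCO : coreIn p (centralizer (P : Set G)) ≤ coreIn p (normalizer (P : Set G)) :=
    le_coreIn ((coreIn_le _).trans (centralizer_le_normalizer _))
      ((normalizer_le_normalizer_centralizer P).trans (normalizer_le_normalizer_coreIn _))
      (isPGroup_coreIn _)
  refine mem_distinguishedBrown_of_centralizer_le (dvd_card_of_mem_tildeBrown hP)
    (isPGroup_coreIn _) ?_
  exact (le_inf (centralizer_le hPO) (centralizer_le hCO)).trans (hC.trans hCO)

theorem le_coreIn_centralizer {T : Subgroup G} (hT : Nat.card T = p) [Fact p.Prime] :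
    T ≤ coreIn p (centralizer (T : Set G)) := by
  have hcomm : T ≤ centralizer (T : Set G) := by
    have : IsCyclic T := isCyclic_of_prime_card hT
    have := IsCyclic.isMulCommutative (α := T)
    exact le_centralizer T
  refine le_coreIn hcomm ?_ (IsPGroup.of_card (n := 1) (by rw [hT, pow_one]))
  exact centralizer_le_normalizer _

theorem centralizer_coreIn_le_of_le_coreIn {T : Subgroup G}
    (hT : T ≤ coreIn p (centralizer (T : Set G)))
    (h : HasCharacteristicP p (centralizer (T : Set G))) :
    centralizer (coreIn p (centralizer (T : Set G)) : Set G) ≤ coreIn p (centralizer (T : Set G)) :=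
  le_trans (le_inf (centralizer_le hT) le_rfl) (hasCharacteristicP_iff.mp h)

/-- `O_p(C_G(T))` contains a `p`-central element if and only if `C_G(T)` has characteristic `p`. -/
theorem coreIn_centralizer_mem_tildeBrown_iff [Finite G] [Fact p.Prime]
    (hG : HasParabolicCharacteristicP p G) {T : Subgroup G} (hT : Nat.card T = p) :
    coreIn p (centralizer (T : Set G)) ∈ tildeBrown p G ↔
      HasCharacteristicP p (centralizer (T : Set G)) := by
  have hTO := le_coreIn_centralizer hT
  set C := centralizer (T : Set G)
  set O := coreIn p C
  constructor
  · intro h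
    have hD := hasCharacteristicP_iff.mp (hG.centralizer_of_mem_tildeBrown h)
    set D := centralizer (O : Set G)
    have hDC : D ≤ C := centralizer_le hTO
    -- `O_p(D)` is a normal `p`-subgroup of `C`, hence inside `O`. Thus `D` centralizes `O_p(D)`,
    -- and characteristic `p` of `D` gives `D ≤ O_p(D) ≤ O`.
    have hDO : coreIn p D ≤ O := le_coreIn ((coreIn_le _).trans hDC)
      ((le_normalizer_coreIn C).trans ((normalizer_le_normalizer_centralizer _).trans
        (normalizer_le_normalizer_coreIn _))) (isPGroup_coreIn _)
    rw [hasCharacteristicP_iff]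
    exact inf_le_right.trans ((le_inf le_rfl (centralizer_le hDO)).trans (hD.trans hDO))
  · intro h
    refine distinguishedBrown_subset_tildeBrown (mem_distinguishedBrown_of_centralizer_le ?_
      (isPGroup_coreIn _) (centralizer_coreIn_le_of_le_coreIn hTO h))
    exact hT ▸ T.card_subgroup_dvd_card

end GroupTheory

/-! ### Contractibility of the fixed points of `T` -/

section FixedPoints

open Subgroup

variable {G : Type*} [Group G] {p : ℕ}

/-- The groups above `P` contract conically to `O = O_p(N_G(P))`, via `R ⊓ N` and `(R ⊓ N)O`. The
point `O` is strictly above `P` because it is distinguished and `P` is not; all groups involved are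
`T`-invariant since `T ≤ N`. -/
theorem contractibleSpace_link_tildeBrown [Finite G] [Fintype (Subgroup G)] [Fact p.Prime]
    (hG : HasParabolicCharacteristicP p G) {T P : Subgroup G}
    (hP : P ∈ fixedCollection (tildeBrown p G) T) (hPd : P ∉ distinguishedBrown p G)
    {L : Set (Subgroup G)} (hL : L ⊆ Set.Iio P) :
    ContractibleSpace
      (chainRealization (L ∪ {R | R ∈ fixedCollection (tildeBrown p G) T ∧ P < R})) := by
  obtain ⟨hPt, hTP⟩ := hP
  set N := normalizer (P : Set G)
  set O := coreIn p N
  have hOp : IsPGroup p O := isPGroup_coreIn N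
  have hPO : P < O := by
    refine lt_of_le_of_ne (le_coreIn_normalizer hPt.1.1) fun h => hPd ?_
    rw [h]
    exact coreIn_normalizer_mem_distinguishedBrown hG hPt
  have hTO : T ≤ normalizer (O : Set G) := hTP.trans (le_normalizer_coreIn N)
  have hfR : ∀ R ∈ fixedCollection (tildeBrown p G) T, P < R →
      IsPGroup p (R ⊓ N : Subgroup G) ∧ P < R ⊓ N ∧
        T ≤ normalizer ((R ⊓ N : Subgroup G) : Set G) := fun R hR hPR =>
    ⟨hR.1.1.1.to_le inf_le_left, lt_inf_normalizer_of_lt hR.1.1.1 hPR,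
      (le_inf hR.2 (hTP.trans le_normalizer)).trans inf_normalizer_le_normalizer_inf⟩
  refine contractibleSpace_union_of_zigzag (f := fun R => R ⊓ N) (g := fun R => R ⊓ N ⊔ O) (a := O)
    hL (fun R hR => hR.2) ?_ ?_ ?_ ?_ (fun _ _ => inf_le_left) (fun _ _ => le_sup_left)
    ⟨⟨tildeBrown_of_le hPt hPO.le hOp, hTO⟩, hPO⟩ (fun _ _ => le_sup_right)
  · rintro R ⟨hR, hPR⟩
    obtain ⟨h1, h2, h3⟩ := hfR R hR hPR
    exact ⟨⟨tildeBrown_of_le hPt h2.le h1, h3⟩, h2⟩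
  · exact fun R _ S _ h => inf_le_inf_right N h
  · rintro R ⟨hR, hPR⟩
    obtain ⟨h1, h2, h3⟩ := hfR R hR hPR
    have h4 : P < R ⊓ N ⊔ O := hPO.trans_le le_sup_right
    exact ⟨⟨tildeBrown_of_le hPt h4.le (h1.to_sup_of_normal_right' hOp
      (inf_le_right.trans (le_normalizer_coreIn N))),
      (le_inf h3 hTO).trans (normalizer_inf_normalizer_le_normalizer_sup _ _)⟩, h4⟩
  · exact fun R _ S _ h => sup_le_sup_right (inf_le_inf_right N h) O

theorem contractibleSpace_distinguishedBrown_above [Finite G] [Fintype (Subgroup G)]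
    [Fact p.Prime] {T : Subgroup G} (hT : Nat.card T = p)
    (hC : HasCharacteristicP p (centralizer (T : Set G))) :
    ContractibleSpace (chainRealization {Q | Q ∈ distinguishedBrown p G ∧ T ≤ Q}) := by
  have hTO := le_coreIn_centralizer hT
  have hCO := centralizer_coreIn_le_of_le_coreIn hTO hC
  have hpG : p ∣ Nat.card G := hT ▸ T.card_subgroup_dvd_card
  set C := centralizer (T : Set G)
  set O := coreIn p C
  have hOp : IsPGroup p O := isPGroup_coreIn C
  refine contractibleSpace_of_zigzag (f := fun Q => Q ⊓ C) (g := fun Q => Q ⊓ C ⊔ O) (a := O)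
    ?_ ?_ ?_ ?_ (fun _ _ => inf_le_left) (fun _ _ => le_sup_left)
    ⟨mem_distinguishedBrown_of_centralizer_le hpG hOp hCO, hTO⟩ (fun _ _ => le_sup_right)
  · rintro Q ⟨hQ, hTQ⟩
    obtain ⟨hQp, z, hzQ, hz, hzp⟩ := mem_distinguishedBrown_iff.mp hQ
    -- A `p`-central `z` in the center of `Q` commutes with `T ≤ Q`, so it survives in `Q ⊓ C` and
    -- is central there.
    exact ⟨mem_distinguishedBrown_iff.mpr ⟨hQp.to_le inf_le_left, z,
      mem_inf.mpr ⟨hzQ, mem_centralizer_iff.mpr fun t ht => hz t (hTQ ht)⟩,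
      fun y hy => hz y (mem_inf.mp hy).1, hzp⟩, le_inf hTQ (hTO.trans (coreIn_le C))⟩
  · exact fun R _ S _ h => inf_le_inf_right C h
  · rintro Q ⟨hQ, hTQ⟩
    refine ⟨mem_distinguishedBrown_of_centralizer_le hpG ?_ ?_, hTO.trans le_sup_right⟩
    · exact (hQ.1.1.to_le inf_le_left).to_sup_of_normal_right' hOp
        (inf_le_right.trans (le_normalizer_coreIn C))
    · exact (centralizer_le (SetLike.coe_subset_coe.mpr le_sup_right)).trans
        (hCO.trans le_sup_right)
  · exact fun R _ S _ h => sup_le_sup_right (inf_le_inf_right C h) O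

theorem contractibleSpace_fixedCollection_distinguishedBrown [Finite G] [Fintype (Subgroup G)]
    [Fact p.Prime] (hG : HasParabolicCharacteristicP p G) {T : Subgroup G} (hT : Nat.card T = p)
    (hC : HasCharacteristicP p (centralizer (T : Set G))) :
    ContractibleSpace (chainRealization (fixedCollection (distinguishedBrown p G) T)) := by
  have hTp : IsPGroup p T := IsPGroup.of_card (n := 1) (by rw [hT, pow_one])
  have hsub := distinguishedBrown_subset_tildeBrown (G := G) (p := p)
  have habove : ContractibleSpace (chainRealization {Q | Q ∈ tildeBrown p G ∧ T ≤ Q}) := by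
    have hle : {Q | Q ∈ distinguishedBrown p G ∧ T ≤ Q} ⊆ {Q | Q ∈ tildeBrown p G ∧ T ≤ Q} :=
      fun Q hQ => ⟨hsub hQ.1, hQ.2⟩
    refine (contractibleSpace_chainRealization_iff_of_subset hle
      fun P hP L hL => ?_).mp (contractibleSpace_distinguishedBrown_above hT hC)
    obtain ⟨⟨hPt, hTP⟩, hPd⟩ := hP
    have hup : {R | R ∈ {Q | Q ∈ tildeBrown p G ∧ T ≤ Q} ∧ P < R} =
        {R | R ∈ fixedCollection (tildeBrown p G) T ∧ P < R} := by
      ext R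
      exact ⟨fun h => ⟨⟨h.1.1, h.1.2.trans le_normalizer⟩, h.2⟩,
        fun h => ⟨⟨h.1.1, hTP.trans h.2.le⟩, h.2⟩⟩
    rw [hup]
    exact contractibleSpace_link_tildeBrown hG ⟨hPt, hTP.trans le_normalizer⟩
      (fun h => hPd ⟨h, hTP⟩) hL
  have hfixed : ContractibleSpace (chainRealization (fixedCollection (tildeBrown p G) T)) := by
    -- This step needs `tilde`: it is closed under passing to larger `p`-groups.
    refine contractibleSpace_of_le_map (f := fun Q => Q ⊔ T)
      (fun Q hQ => ⟨hQ.1, hQ.2.trans le_normalizer⟩) ?_ ?_ (fun _ _ => le_sup_left) habove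
    · rintro Q ⟨hQ, hTQ⟩
      exact ⟨tildeBrown_of_le hQ le_sup_left (hQ.1.1.to_sup_of_normal_left' hTp hTQ), le_sup_right⟩
    · exact fun R _ S _ h => sup_le_sup_right h T
  have hle : fixedCollection (distinguishedBrown p G) T ⊆ fixedCollection (tildeBrown p G) T :=
    fun Q hQ => ⟨hsub hQ.1, hQ.2⟩
  refine (contractibleSpace_chainRealization_iff_of_subset hle
    fun P hP L hL => ?_).mpr hfixed
  exact contractibleSpace_link_tildeBrown hG hP.1 (fun h => hP.2 ⟨h, hP.1.2⟩) hL

end FixedPoints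

theorem proposition4p6 {G : Type*} [Group G] [Finite G] (p : ℕ) [Fact p.Prime]
    (hG : HasParabolicCharacteristicP p G)
    (T : Subgroup G) (hT : IsNoncentralSubgroup p T) :
    (centralizerCore p T ∈ tildeBrown p G →
      IsContractibleCollection (fixedCollection (distinguishedBrown p G) T)) ∧
    (centralizerCore p T ∈ tildeBrown p G ↔
      HasCharacteristicP p (Subgroup.centralizer (T : Set G))) := by
  have hb : centralizerCore p T ∈ tildeBrown p G ↔
      HasCharacteristicP p (Subgroup.centralizer (T : Set G)) :=
    coreIn_centralizer_mem_tildeBrown_iff hG hT.1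
  refine ⟨fun h => ?_, hb⟩
  have := Fintype.ofFinite (Subgroup G)
  exact (geomRealizationHomeomorph _).contractibleSpace_iff.mpr
    (contractibleSpace_fixedCollection_distinguishedBrown hG hT.1 (hb.mp h))
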